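/- An edge partition tree (EPT) of a finite tree $G$ is a rooted full binary tree $T$ defined recursively: if $G$ has a single vertex, $T$ is a single node, which is that vertex; otherwise the root of $T$ is an edge $e\in E(G)$, and the subtrees of $T$ rooted at its two children are EPTs of the two components of $G\setminus e$. Thus the leaves of $T$ are the vertices of $G$ and its internal nodes are the edges of $G$. Let $\mathsf{EPT\text{-}sum}(G,T)$ be the sum of the depths of all leaves of $T$ (the root has depth $0$), and let $\mathsf{EPT\text{-}sum}(G)$ be the minimum of $\mathsf{EPT\text{-}sum}(G,T)$ over all EPTs $T$ of $G$. The balanced cut algorithm builds a rooted tree from $G$ as follows: if $G$ has a single vertex, it returns that vertex as a single node; otherwise it chooses an edge $e$ of $G$ that minimizes the number of vertices of the biggest component of $G\setminus e$ (ties are broken arbitrarily), makes $e$ the root, and makes the roots of the trees that it builds recursively for the two components of $G\setminus e$ the children of $e$. **Theorem.** Let $G$ be a finite tree. The balanced cut algorithm has an output on $G$, and every possible output $T$ (for every way of breaking ties) is an EPT of $G$ with $$\mathsf{EPT\text{-}sum}(G,T)\;\le\;\tfrac32\,\mathsf{EPT\text{-}sum}(G).$$ -/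

import Mathlib

/-- Rooted full binary trees whose leaves are labelled by vertices and whose internal nodes are
labelled by (potential) edges of a graph on `V`. -/
inductive EPTree (V : Type*) where
  | leaf (v : V) : EPTree V
  | node (e : Sym2 V) (left right : EPTree V) : EPTree V

/-- The sum of the depths of all leaves of `T`, when the root of `T` is placed at depth `d`. -/
def EPTree.leafDepthSumFrom {V : Type*} : ℕ → EPTree V → ℕ
  | d, .leaf _ => d
  | d, .node _ l r => leafDepthSumFrom (d + 1) l + leafDepthSumFrom (d + 1) r

/-- The sum of the depths of all leaves of `T`; the root has depth `0`. If `T` is an edge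
partition tree of `G`, this is the EPT-sum of `G` with respect to `T`. -/
def EPTree.leafDepthSum {V : Type*} (T : EPTree V) : ℕ :=
  T.leafDepthSumFrom 0

/-- The edge set of the induced subgraph `G[S]`. -/
def inducedEdges {V : Type*} (G : SimpleGraph V) (S : Finset V) : Set (Sym2 V) :=
  {e | e ∈ G.edgeSet ∧ ∀ x ∈ e, x ∈ S}

/-- The graph `G[S] \ e`: the induced subgraph of `G` on `S` with the edge `e` removed, viewed as
a graph on `V` (the elements of `V` outside of `S` are isolated in it and play no role). -/
def cutGraph {V : Type*} (G : SimpleGraph V) (S : Finset V) (e : Sym2 V) : SimpleGraph V where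
  Adj a b := s(a, b) ∈ inducedEdges G S ∧ s(a, b) ≠ e
  symm := ⟨fun a b h => by rwa [Sym2.eq_swap (a := b) (b := a)]⟩
  loopless := ⟨fun a h => G.irrefl h.1.1⟩

open Classical in
/-- The vertex set of the component of `G[S] \ e` that contains `x` (for `x ∈ S`). -/
noncomputable def cutComponent {V : Type*} (G : SimpleGraph V) (S : Finset V) (e : Sym2 V)
    (x : V) : Finset V :=
  {y ∈ S | (cutGraph G S e).Reachable x y}

/-- The number of vertices of a biggest component of `G[S] \ e`. -/
noncomputable def maxComponentSize {V : Type*} (G : SimpleGraph V) (S : Finset V)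
    (e : Sym2 V) : ℕ :=
  S.sup fun x => (cutComponent G S e x).card

/-- `e` is a balanced cut of `G[S]`: an edge of `G[S]` that minimizes the size of the biggest
component of `G[S] \ e`. -/
def IsBalancedCut {V : Type*} (G : SimpleGraph V) (S : Finset V) (e : Sym2 V) : Prop :=
  e ∈ inducedEdges G S ∧
    ∀ f ∈ inducedEdges G S, maxComponentSize G S e ≤ maxComponentSize G S f

/-- `IsEPT G S T`: the rooted tree `T` is an edge partition tree of `G[S]`, where `G` is a tree
and `G[S]` is connected. The EPT of a one-vertex graph is a single leaf. Otherwise the root is an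
edge `uv` of `G[S]`, and its two children are the roots of EPTs of the two components of
`G[S] \ uv`, that of `u` and that of `v`. (As `G` is a tree, `uv` is a bridge of `G[S]`, so these
are different and are all the components, and each of them is an induced subgraph of `G`.
The order of the two children is immaterial, since `s(u, v) = s(v, u)`.) -/
inductive IsEPT {V : Type*} (G : SimpleGraph V) : Finset V → EPTree V → Prop
  | leaf (v : V) : IsEPT G {v} (.leaf v)
  | node (S : Finset V) (u v : V) (l r : EPTree V) (he : s(u, v) ∈ inducedEdges G S)
      (hl : IsEPT G (cutComponent G S s(u, v) u) l)
      (hr : IsEPT G (cutComponent G S s(u, v) v) r) :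
      IsEPT G S (.node s(u, v) l r)

/-- `IsBalancedCutOutput G S T`: the rooted tree `T` is a possible output of the balanced cut
algorithm on the tree `G[S]`. On one vertex the algorithm returns a single leaf. Otherwise it
chooses a balanced cut `uv` of `G[S]` (with an arbitrary choice among ties), makes it the root,
and attaches to it the outputs of recursive calls on the two components of `G[S] \ uv`. -/
inductive IsBalancedCutOutput {V : Type*} (G : SimpleGraph V) : Finset V → EPTree V → Prop
  | leaf (v : V) : IsBalancedCutOutput G {v} (.leaf v)
  | node (S : Finset V) (u v : V) (l r : EPTree V) (he : IsBalancedCut G S s(u, v))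
      (hl : IsBalancedCutOutput G (cutComponent G S s(u, v) u) l)
      (hr : IsBalancedCutOutput G (cutComponent G S s(u, v) v) r) :
      IsBalancedCutOutput G S (.node s(u, v) l r)

/-- The EPT-sum of the tree `G`: the minimum of the sum of leaf depths over all EPTs of `G`. -/
noncomputable def eptSum {V : Type*} [Fintype V] (G : SimpleGraph V) : ℕ :=
  sInf {n | ∃ T : EPTree V, IsEPT G Finset.univ T ∧ T.leafDepthSum = n}

/-! ### The two sides of an edge. -/

section Halves

variable {V : Type*} {G : SimpleGraph V} {S : Finset V} {u v x y w : V}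

/-! Let `uv` be a balanced cut of a subtree `S`, with parts `U`, `V` and `|U| ≤ |V|`, and let `T` be
any EPT of `S`. Splitting `T` along `uv` gives EPTs of `U` and `V`; the drop in total leaf depth is
the saving. The algorithm pays `|S|` at its root and, by induction, is within `3/2` on both parts,
so a saving of `2|S|/3` suffices.

Balance enters through `IsBalancedCut.card_half_le`: an edge inside `V` cuts off, away from `uv`, at
most `|U|` vertices. Hence the saving is at least the size of either part cut by the root of `T`
(`IsBalancedCut.hasSaving`), which gives the sharper induction bound `ApproxBelow.add_card_half_le`,
useful when the root of `T` is unbalanced. `ApproxBelow.step` combines these according to where the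
root of `T` lies; only when it cuts more than `|S|/3` vertices off `V` must the next level of `T` be
examined too. -/

/-- `w` lies on the side of `u` when the edge `uv` is removed from `G`. -/
def OnSide (G : SimpleGraph V) (u v w : V) : Prop :=
  (G.deleteEdges {s(u, v)}).Reachable u w

theorem onSide_self (G : SimpleGraph V) (u v : V) : OnSide G u v u :=
  SimpleGraph.Reachable.refl u

theorem OnSide.of_adj (h : OnSide G u v x) (hxy : G.Adj x y) (hne : s(x, y) ≠ s(u, v)) :
    OnSide G u v y :=
  SimpleGraph.Reachable.trans h
    (SimpleGraph.Adj.reachable (SimpleGraph.deleteEdges_adj.2 ⟨hxy, hne⟩))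

theorem onSide_or_onSide (hG : G.IsTree) (u v w : V) : OnSide G u v w ∨ OnSide G v u w := by
  obtain ⟨p⟩ := hG.connected.preconnected w u
  induction p with
  | nil => exact Or.inl (onSide_self _ _ _)
  | @cons a b c h p ih =>
    by_cases hne : s(b, a) = s(c, v)
    · rcases Sym2.eq_iff.1 hne with ⟨-, rfl⟩ | ⟨-, rfl⟩
      · exact Or.inr (onSide_self _ _ _)
      · exact Or.inl (onSide_self _ _ _)
    · exact ih.imp (fun h' => h'.of_adj h.symm hne)
        (fun h' => h'.of_adj h.symm (by rwa [Sym2.eq_swap (a := v)]))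

theorem not_onSide_of_onSide (hG : G.IsTree) (huv : G.Adj u v) (h : OnSide G u v w) :
    ¬ OnSide G v u w := by
  intro h'
  have hb := SimpleGraph.isAcyclic_iff_forall_adj_isBridge.1 hG.isAcyclic huv
  refine SimpleGraph.isBridge_iff.1 hb ?_
  unfold OnSide at h h'
  rw [Sym2.eq_swap] at h'
  exact h.trans h'.symm

theorem onSide_swap_iff (hG : G.IsTree) (huv : G.Adj u v) :
    OnSide G v u w ↔ ¬ OnSide G u v w :=
  ⟨fun h h' => not_onSide_of_onSide hG huv h' h, (onSide_or_onSide hG u v w).resolve_left⟩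

theorem ne_of_onSide_onSide (hG : G.IsTree) (huv : G.Adj u v)
    (hx : OnSide G u v x) (hy : OnSide G u v y) : s(x, y) ≠ s(u, v) := by
  intro h
  have hv := not_onSide_of_onSide hG huv.symm (onSide_self G v u)
  rcases Sym2.eq_iff.1 h with ⟨-, rfl⟩ | ⟨rfl, -⟩ <;> contradiction

/-- If the edge `xy` lies on the side of `u`, and `u` lies on the side of `y`, then so does
everything beyond the edge `uv`. -/
theorem OnSide.laminar (hG : G.IsTree) (huv : G.Adj u v)
    (hx : OnSide G u v x) (hy : OnSide G u v y) (hu : OnSide G y x u) (hw : OnSide G v u w) :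
    OnSide G y x w := by
  have hne := ne_of_onSide_onSide hG huv hx hy
  have hv : OnSide G y x v := hu.of_adj huv (by rw [Sym2.eq_swap (a := y)]; exact hne.symm)
  -- A walk from `v` avoiding `uv` stays on the side of `v`, so it cannot use `xy`, both of whose
  -- ends are on the side of `u`.
  have key : ∀ z, (G.deleteEdges {s(v, u)}).Walk z w → OnSide G v u z → OnSide G y x z →
      OnSide G y x w := by
    intro z p
    induction p with
    | nil => exact fun _ h => h
    | @cons a b c h p ih =>
      intro h1 h2
      have hab := SimpleGraph.deleteEdges_adj.1 h
      have hab1 : G.Adj a b := hab.1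
      refine ih hw (h1.of_adj hab1 hab.2) (h2.of_adj hab1 ?_)
      intro he
      rcases Sym2.eq_iff.1 he with ⟨rfl, -⟩ | ⟨rfl, -⟩
      · exact not_onSide_of_onSide hG huv hy h1
      · exact not_onSide_of_onSide hG huv hx h1
  obtain ⟨p⟩ := id hw
  exact key v p (onSide_self _ _ _) hv

/-! ### Edge-convex sets, their halves, and balanced cuts. -/

/-- A set of vertices is edge-convex if it contains every edge that separates two of its
vertices. -/
def EdgeConvex (G : SimpleGraph V) (S : Finset V) : Prop :=
  ∀ u v, G.Adj u v → (∃ a ∈ S, OnSide G u v a) → (∃ b ∈ S, OnSide G v u b) → u ∈ S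

open Classical in
/-- The part of `S` on the side of `u` when the edge `uv` is removed. -/
noncomputable def half (G : SimpleGraph V) (S : Finset V) (u v : V) : Finset V :=
  {w ∈ S | OnSide G u v w}

theorem mem_half : w ∈ half G S u v ↔ w ∈ S ∧ OnSide G u v w := by
  classical
  simp [half]

theorem half_subset : half G S u v ⊆ S := fun _ h => (mem_half.1 h).1

theorem half_mono {R : Finset V} (h : R ⊆ S) : half G R u v ⊆ half G S u v :=
  fun _ hw => mem_half.2 ⟨h (mem_half.1 hw).1, (mem_half.1 hw).2⟩

theorem card_half_add_card_half (hG : G.IsTree) (huv : G.Adj u v) (S : Finset V) :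
    (half G S u v).card + (half G S v u).card = S.card := by
  classical
  have h : half G S v u = {w ∈ S | ¬ OnSide G u v w} := by
    ext w
    simp [mem_half, onSide_swap_iff hG huv]
  rw [h]
  convert Finset.card_filter_add_card_filter_not (s := S) (OnSide G u v)
  unfold half
  rfl

/-- If a separating edge `uv` had `u` beyond `xy`, then `v` would be there too, and by laminarity
the whole side of `x` would lie on a single side of `uv`. -/
theorem EdgeConvex.half (hG : G.IsTree) (hS : EdgeConvex G S) (hxy : G.Adj x y) :
    EdgeConvex G (half G S x y) := by
  rintro u v huv ⟨a, ha, hua⟩ ⟨b, hb, hvb⟩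
  rw [mem_half] at ha hb
  refine mem_half.2 ⟨hS u v huv ⟨a, ha.1, hua⟩ ⟨b, hb.1, hvb⟩, ?_⟩
  by_contra hu
  rw [← onSide_swap_iff hG hxy] at hu
  have hne : s(u, v) ≠ s(y, x) := by
    intro he
    rcases Sym2.eq_iff.1 he with ⟨rfl, rfl⟩ | ⟨rfl, rfl⟩
    · exact not_onSide_of_onSide hG hxy ha.2 hua
    · exact not_onSide_of_onSide hG hxy hb.2 hvb
  have hv := hu.of_adj huv hne
  rcases onSide_or_onSide hG u v y with h | h
  · exact not_onSide_of_onSide hG huv (OnSide.laminar hG hxy.symm hv hu h hb.2) hvb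
  · exact not_onSide_of_onSide hG huv.symm (OnSide.laminar hG hxy.symm hu hv h ha.2) hua

/-- Each edge of a path in a tree separates the ends of the path, so edge-convexity keeps the path
inside `S`. This identifies components of `G[S] \ e` with halves. -/
theorem EdgeConvex.reachable_cutGraph (hS : EdgeConvex G S) {a b : V}
    (p : (G.deleteEdges {s(u, v)}).Walk a b) (hp : p.IsPath) (ha : a ∈ S) (hb : b ∈ S) :
    (cutGraph G S s(u, v)).Reachable a b := by
  induction p with
  | nil => exact SimpleGraph.Reachable.refl _
  | @cons a z b h p ih =>
    rw [SimpleGraph.Walk.cons_isPath_iff] at hp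
    have haz := SimpleGraph.deleteEdges_adj.1 h
    have haz1 : G.Adj a z := haz.1
    have hz : z ∈ S := by
      refine hS z a haz1.symm ⟨b, hb, ?_⟩ ⟨a, ha, onSide_self _ _ _⟩
      refine ⟨(p.mapLe (SimpleGraph.deleteEdges_le _)).toDeleteEdge s(z, a) ?_⟩
      intro he
      have := SimpleGraph.Walk.snd_mem_support_of_mem_edges _ he
      simp at this
      exact hp.2 this
    refine SimpleGraph.Reachable.trans (SimpleGraph.Adj.reachable ?_) (ih hp.1 hz hb)
    refine ⟨⟨haz1, ?_⟩, haz.2⟩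
    intro c hc
    rcases Sym2.mem_iff.1 hc with rfl | rfl <;> assumption

theorem cutGraph_le (G : SimpleGraph V) (S : Finset V) (e : Sym2 V) :
    cutGraph G S e ≤ G.deleteEdges {e} := by
  intro a b h
  exact SimpleGraph.deleteEdges_adj.2 ⟨h.1.1, h.2⟩

theorem cutComponent_eq_half (hS : EdgeConvex G S) (hu : u ∈ S) :
    cutComponent G S s(u, v) u = half G S u v := by
  classical
  ext w
  simp only [cutComponent, Finset.mem_filter, mem_half]
  refine and_congr_right fun hw => ⟨fun h => h.mono (cutGraph_le _ _ _), fun h => ?_⟩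
  obtain ⟨p, hp⟩ := SimpleGraph.Reachable.exists_isPath h
  exact hS.reachable_cutGraph p hp hu hw

theorem cutComponent_eq_half' (hS : EdgeConvex G S) (hv : v ∈ S) :
    cutComponent G S s(u, v) v = half G S v u := by
  rw [Sym2.eq_swap, cutComponent_eq_half hS hv]

theorem mem_inducedEdges : s(u, v) ∈ inducedEdges G S ↔ G.Adj u v ∧ u ∈ S ∧ v ∈ S := by
  simp [inducedEdges]

theorem maxComponentSize_le (hG : G.IsTree) (hS : EdgeConvex G S) (hu : u ∈ S) (hv : v ∈ S) :
    maxComponentSize G S s(u, v) ≤ max (half G S u v).card (half G S v u).card := by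
  classical
  refine Finset.sup_le fun z hz => ?_
  have key : ∀ c, z ∈ cutComponent G S s(u, v) c →
      cutComponent G S s(u, v) z ⊆ cutComponent G S s(u, v) c := by
    intro c hc w hw
    simp only [cutComponent, Finset.mem_filter] at hc hw ⊢
    exact ⟨hw.1, hc.2.trans hw.2⟩
  rcases onSide_or_onSide hG u v z with h | h
  · have := key u (by rw [cutComponent_eq_half hS hu]; exact mem_half.2 ⟨hz, h⟩)
    rw [cutComponent_eq_half hS hu] at this
    exact le_max_of_le_left (Finset.card_le_card this)
  · have := key v (by rw [cutComponent_eq_half' hS hv]; exact mem_half.2 ⟨hz, h⟩)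
    rw [cutComponent_eq_half' hS hv] at this
    exact le_max_of_le_right (Finset.card_le_card this)

theorem card_half_le_maxComponentSize (hS : EdgeConvex G S) (hv : v ∈ S) :
    (half G S v u).card ≤ maxComponentSize G S s(u, v) := by
  rw [← cutComponent_eq_half' hS hv]
  exact Finset.le_sup (f := fun z => (cutComponent G S s(u, v) z).card) hv

theorem card_half_lt (hG : G.IsTree) (huv : G.Adj u v) (hv : v ∈ S) :
    (half G S u v).card < S.card := by
  refine Finset.card_lt_card ⟨half_subset, fun h => ?_⟩
  exact not_onSide_of_onSide hG huv.symm (onSide_self G v u) (mem_half.1 (h hv)).2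

/-- Every edge on the larger side of a balanced cut on one side of a balanced cut cuts off at most as many vertices
as there are on the other side. -/
theorem IsBalancedCut.card_half_le (hG : G.IsTree) (hS : EdgeConvex G S)
    (h : IsBalancedCut G S s(u, v)) (hxy : G.Adj x y) (hxS : x ∈ S) (hyS : y ∈ S) (hx : OnSide G v u x) (hy : OnSide G v u y)
    (hv : OnSide G y x v) : (half G S x y).card ≤ (half G S u v).card := by
  obtain ⟨huv, huS, hvS⟩ := mem_inducedEdges.1 h.1
  have h1 := h.2 s(x, y) (mem_inducedEdges.2 ⟨hxy, hxS, hyS⟩)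
  have h2 := maxComponentSize_le hG hS hxS hyS
  have h3 := card_half_le_maxComponentSize (u := u) hS hvS
  have h4 : (half G S x y).card < (half G S v u).card := by
    refine Finset.card_lt_card ⟨fun w hw => ?_, fun hsub => ?_⟩
    · rw [mem_half] at hw ⊢
      refine ⟨hw.1, ?_⟩
      rw [onSide_swap_iff hG huv]
      intro hw'
      exact not_onSide_of_onSide hG hxy hw.2 (OnSide.laminar hG huv.symm hx hy hv hw')
    · have := mem_half.1 (hsub (mem_half.2 ⟨hvS, onSide_self G v u⟩))
      exact not_onSide_of_onSide hG hxy this.2 hv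
  have h5 := card_half_add_card_half hG huv S
  have h6 := card_half_add_card_half hG hxy S
  -- If `|X| > |U|`, both parts of the cut `xy` would be smaller than `V`: one is properly contained
  -- in `V`, the other has `|S| - |X| < |S| - |U| = |V|` vertices.
  omega

end Halves

/-! ### Edge partition trees and the position of their root. -/

section Savings

variable {V : Type*} {G : SimpleGraph V} {S : Finset V} {u v x y : V} {T l r : EPTree V}

/-- The tree has one leaf per vertex of `S`. It follows that each internal node contributes the size
of the set it cuts. -/
theorem IsEPT.leafDepthSumFrom_eq (hG : G.IsTree) (hT : IsEPT G S T) (hS : EdgeConvex G S)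
    (d : ℕ) : T.leafDepthSumFrom d = d * S.card + T.leafDepthSum := by
  induction hT generalizing d with
  | leaf v => simp [EPTree.leafDepthSumFrom, EPTree.leafDepthSum]
  | node S u v l r he _ _ ihl ihr =>
    obtain ⟨huv, hu, hv⟩ := mem_inducedEdges.1 he
    rw [cutComponent_eq_half hS hu] at ihl
    rw [cutComponent_eq_half' hS hv] at ihr
    have h1 := ihl (hS.half hG huv)
    have h2 := ihr (hS.half hG huv.symm)
    simp only [EPTree.leafDepthSum, EPTree.leafDepthSumFrom] at h1 h2 ⊢
    rw [h1, h2, h1 (0 + 1), h2 (0 + 1), ← card_half_add_card_half hG huv S]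
    ring

theorem IsEPT.leafDepthSum_node (hG : G.IsTree) (hS : EdgeConvex G S) (huv : G.Adj u v)
    (hl : IsEPT G (half G S u v) l) (hr : IsEPT G (half G S v u) r) :
    (EPTree.node s(u, v) l r).leafDepthSum = S.card + l.leafDepthSum + r.leafDepthSum := by
  have h1 := hl.leafDepthSumFrom_eq hG (hS.half hG huv) 1
  have h2 := hr.leafDepthSumFrom_eq hG (hS.half hG huv.symm) 1
  have h3 := card_half_add_card_half hG huv S
  rw [EPTree.leafDepthSum, EPTree.leafDepthSumFrom, h1, h2]
  omega

theorem IsEPT.node_half (hS : EdgeConvex G S) (huv : G.Adj u v) (hu : u ∈ S) (hv : v ∈ S)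
    (hl : IsEPT G (half G S u v) l) (hr : IsEPT G (half G S v u) r) :
    IsEPT G S (.node s(u, v) l r) := by
  refine IsEPT.node S u v l r (mem_inducedEdges.2 ⟨huv, hu, hv⟩) ?_ ?_
  · rwa [cutComponent_eq_half hS hu]
  · rwa [cutComponent_eq_half' hS hv]

theorem IsEPT.exists_of_ne (hG : G.IsTree) (hS : EdgeConvex G S) (hT : IsEPT G S T)
    (hu : u ∈ S) (hv : v ∈ S) (huv : u ≠ v) :
    ∃ x y l r, T = .node s(x, y) l r ∧ G.Adj x y ∧ x ∈ S ∧ y ∈ S ∧ IsEPT G (half G S x y) l ∧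
      IsEPT G (half G S y x) r ∧
      T.leafDepthSum = S.card + l.leafDepthSum + r.leafDepthSum := by
  cases hT with
  | leaf w =>
    rw [Finset.mem_singleton] at hu hv
    exact absurd (hu.trans hv.symm) huv
  | node _ x y l r he hl hr =>
    obtain ⟨hxy, hx, hy⟩ := mem_inducedEdges.1 he
    rw [cutComponent_eq_half hS hx] at hl
    rw [cutComponent_eq_half' hS hy] at hr
    exact ⟨x, y, l, r, rfl, hxy, hx, hy, hl, hr, IsEPT.leafDepthSum_node hG hS hxy hl hr⟩

/-- The edge partition trees `l` and `r` of the two parts of `S` cut by the edge `xy`, where `xy`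
lies on the side of `u` with respect to the edge `uv` and `y` is the endpoint that is closer
to `u`. -/
structure CutsSide (G : SimpleGraph V) (S : Finset V) (u v x y : V) (l r : EPTree V) : Prop where
  convex : EdgeConvex G S
  adj : G.Adj u v
  left_mem : u ∈ S
  right_mem : v ∈ S
  cut_adj : G.Adj x y
  far_mem : x ∈ S
  near_mem : y ∈ S
  far_onSide : OnSide G u v x
  near_onSide : OnSide G u v y
  onSide_near : OnSide G y x u
  isEPT_far : IsEPT G (half G S x y) l
  isEPT_near : IsEPT G (half G S y x) r

namespace CutsSide

variable (h : CutsSide G S u v x y l r)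
include h

theorem onSide_near_right (hG : G.IsTree) : OnSide G y x v :=
  OnSide.laminar hG h.adj h.far_onSide h.near_onSide h.onSide_near (onSide_self _ _ _)

theorem onSide_of_onSide_far (hG : G.IsTree) {w : V} (hw : OnSide G x y w) : OnSide G u v w := by
  by_contra hn
  rw [← onSide_swap_iff hG h.adj] at hn
  exact not_onSide_of_onSide hG h.cut_adj hw
    (OnSide.laminar hG h.adj h.far_onSide h.near_onSide h.onSide_near hn)

theorem half_half_right (hG : G.IsTree) : half G (half G S y x) v u = half G S v u := by
  ext w
  simp only [mem_half]
  refine ⟨fun hw => ⟨hw.1.1, hw.2⟩, fun hw => ⟨⟨hw.1, ?_⟩, hw.2⟩⟩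
  exact OnSide.laminar hG h.adj h.far_onSide h.near_onSide h.onSide_near hw.2

theorem half_half_far (hG : G.IsTree) : half G (half G S u v) x y = half G S x y := by
  ext w
  simp only [mem_half]
  exact ⟨fun hw => ⟨hw.1.1, hw.2⟩, fun hw => ⟨⟨hw.1, h.onSide_of_onSide_far hG hw.2⟩, hw.2⟩⟩

omit h in
theorem half_half_comm (u v x y : V) :
    half G (half G S u v) y x = half G (half G S y x) u v := by
  ext w
  simp only [mem_half]
  tauto

theorem card_half_half (hG : G.IsTree) :
    (half G (half G S y x) u v).card + (half G S x y).card = (half G S u v).card := by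
  rw [← card_half_add_card_half hG h.cut_adj (half G S u v), h.half_half_far hG, add_comm,
    half_half_comm]

/-- The root `xy` is kept for the half of `u`, with the far subtree `l` untouched and the near
subtree replaced by its restriction. -/
theorem isEPT_node {t : EPTree V} (hG : G.IsTree)
    (ht : IsEPT G (half G (half G S y x) u v) t) :
    IsEPT G (half G S u v) (.node s(x, y) l t) ∧
      (EPTree.node s(x, y) l t).leafDepthSum =
        (half G S u v).card + l.leafDepthSum + t.leafDepthSum := by
  have hc := h.convex.half hG h.adj
  have hl := h.isEPT_far
  rw [← h.half_half_far hG] at hl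
  rw [← half_half_comm] at ht
  exact ⟨IsEPT.node_half hc h.cut_adj (mem_half.2 ⟨h.far_mem, h.far_onSide⟩)
    (mem_half.2 ⟨h.near_mem, h.near_onSide⟩) hl ht,
    IsEPT.leafDepthSum_node hG hc h.cut_adj hl ht⟩

end CutsSide

/-- The root of an edge partition tree of `S` is the edge `uv`, or lies on one of its two sides. -/
theorem IsEPT.root_cases (hG : G.IsTree) (hS : EdgeConvex G S) (huv : G.Adj u v)
    (hu : u ∈ S) (hv : v ∈ S) (hxy : G.Adj x y) (hx : x ∈ S) (hy : y ∈ S)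
    (hl : IsEPT G (half G S x y) l) (hr : IsEPT G (half G S y x) r) :
    ((x = u ∧ y = v) ∨ (x = v ∧ y = u)) ∨
      (CutsSide G S u v x y l r ∨ CutsSide G S u v y x r l) ∨
      (CutsSide G S v u x y l r ∨ CutsSide G S v u y x r l) := by
  by_cases hne : s(x, y) = s(u, v)
  · exact Or.inl (Sym2.eq_iff.1 hne)
  · right
    have hne' : s(x, y) ≠ s(v, u) := by rwa [Sym2.eq_swap (a := v)]
    rcases onSide_or_onSide hG u v x with h | h
    · have hy' := h.of_adj hxy hne
      left
      rcases onSide_or_onSide hG y x u with h' | h'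
      · exact Or.inl ⟨hS, huv, hu, hv, hxy, hx, hy, h, hy', h', hl, hr⟩
      · exact Or.inr ⟨hS, huv, hu, hv, hxy.symm, hy, hx, hy', h, h', hr, hl⟩
    · have hy' := h.of_adj hxy hne'
      right
      rcases onSide_or_onSide hG y x v with h' | h'
      · exact Or.inl ⟨hS, huv.symm, hv, hu, hxy, hx, hy, h, hy', h', hl, hr⟩
      · exact Or.inr ⟨hS, huv.symm, hv, hu, hxy.symm, hy, hx, hy', h, h', hr, hl⟩

/-- A version of `IsEPT.root_cases` in which the labels of the root are chosen suitably. -/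
theorem IsEPT.cases_at (hG : G.IsTree) (hS : EdgeConvex G S) (hT : IsEPT G S T)
    (huv : G.Adj u v) (hu : u ∈ S) (hv : v ∈ S) :
    (∃ l r, IsEPT G (half G S u v) l ∧ IsEPT G (half G S v u) r ∧
      T.leafDepthSum = S.card + l.leafDepthSum + r.leafDepthSum) ∨
    (∃ x y l r, CutsSide G S u v x y l r ∧
      T.leafDepthSum = S.card + l.leafDepthSum + r.leafDepthSum) ∨
    (∃ x y l r, CutsSide G S v u x y l r ∧
      T.leafDepthSum = S.card + l.leafDepthSum + r.leafDepthSum) := by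
  obtain ⟨x, y, l, r, -, hxy, hx, hy, hl, hr, hc⟩ := hT.exists_of_ne hG hS hu hv huv.ne
  have hc' : T.leafDepthSum = S.card + r.leafDepthSum + l.leafDepthSum := by omega
  rcases IsEPT.root_cases hG hS huv hu hv hxy hx hy hl hr with
    (⟨rfl, rfl⟩ | ⟨rfl, rfl⟩) | (h | h) | (h | h)
  · exact Or.inl ⟨l, r, hl, hr, hc⟩
  · exact Or.inl ⟨r, l, hr, hl, hc'⟩
  · exact Or.inr (Or.inl ⟨x, y, l, r, h, hc⟩)
  · exact Or.inr (Or.inl ⟨y, x, r, l, h, hc'⟩)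
  · exact Or.inr (Or.inr ⟨x, y, l, r, h, hc⟩)
  · exact Or.inr (Or.inr ⟨y, x, r, l, h, hc'⟩)

/-! ### Savings from splitting a tree along an edge. -/

/-- The two parts of `S` cut by `uv` have edge partition trees whose total leaf depth is smaller
than that of `T` by at least `s`. -/
def HasSaving (G : SimpleGraph V) (S : Finset V) (u v : V) (T : EPTree V) (s : ℕ) : Prop :=
  ∃ l r, IsEPT G (half G S u v) l ∧ IsEPT G (half G S v u) r ∧
    l.leafDepthSum + r.leafDepthSum + s ≤ T.leafDepthSum

theorem HasSaving.mono {s t : ℕ} (h : HasSaving G S u v T s) (hts : t ≤ s) :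
    HasSaving G S u v T t := by
  obtain ⟨l, r, hl, hr, hc⟩ := h
  exact ⟨l, r, hl, hr, by omega⟩

theorem HasSaving.symm {s : ℕ} (h : HasSaving G S u v T s) : HasSaving G S v u T s := by
  obtain ⟨l, r, hl, hr, hc⟩ := h
  exact ⟨r, l, hr, hl, by omega⟩

/-- A root on the side of `u` is kept only in the tree of that side, so every leaf on the side of
`v` rises by one level; the rest is the saving in the near subtree. -/
theorem CutsSide.hasSaving (hG : G.IsTree) (h : CutsSide G S u v x y l r)
    (hc : T.leafDepthSum = S.card + l.leafDepthSum + r.leafDepthSum) {s : ℕ}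
    (hs : HasSaving G (half G S y x) u v r s) :
    HasSaving G S u v T ((half G S v u).card + s) := by
  obtain ⟨tl, tr, htl, htr, ht⟩ := hs
  rw [h.half_half_right hG] at htr
  obtain ⟨h1, h2⟩ := h.isEPT_node hG htl
  have h3 := card_half_add_card_half hG h.adj S
  exact ⟨_, tr, h1, htr, by omega⟩

theorem CutsSide.mem_near (h : CutsSide G S u v x y l r) (hG : G.IsTree) :
    EdgeConvex G (half G S y x) ∧ u ∈ half G S y x ∧ v ∈ half G S y x :=
  ⟨h.convex.half hG h.cut_adj.symm, mem_half.2 ⟨h.left_mem, h.onSide_near⟩,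
    mem_half.2 ⟨h.right_mem, h.onSide_near_right hG⟩⟩

theorem IsEPT.hasSaving_zero (hG : G.IsTree) (hS : EdgeConvex G S) (hT : IsEPT G S T)
    (huv : G.Adj u v) (hu : u ∈ S) (hv : v ∈ S) : HasSaving G S u v T 0 := by
  induction hn : S.card using Nat.strong_induction_on generalizing S T with
  | _ n ih =>
    rcases hT.cases_at hG hS huv hu hv with
      ⟨l, r, hl, hr, hc⟩ | ⟨x, y, l, r, h, hc⟩ | ⟨x, y, l, r, h, hc⟩
    · exact ⟨l, r, hl, hr, by omega⟩
    · obtain ⟨h1, h2, h3⟩ := h.mem_near hG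
      have hlt := card_half_lt hG h.cut_adj.symm h.far_mem
      exact (h.hasSaving hG hc (ih _ (hn ▸ hlt) h1 h.isEPT_near h2 h3 rfl)).mono (by omega)
    · obtain ⟨h1, h2, h3⟩ := h.mem_near hG
      have hlt := card_half_lt hG h.cut_adj.symm h.far_mem
      exact ((h.hasSaving hG hc
        (ih _ (hn ▸ hlt) h1 h.isEPT_near h3 h2 rfl).symm).mono (by omega)).symm

theorem IsEPT.hasSaving_min (hG : G.IsTree) (hS : EdgeConvex G S) (hT : IsEPT G S T)
    (huv : G.Adj u v) (hu : u ∈ S) (hv : v ∈ S) :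
    HasSaving G S u v T (min (half G S u v).card (half G S v u).card) := by
  have hcard := card_half_add_card_half hG huv S
  rcases hT.cases_at hG hS huv hu hv with
    ⟨l, r, hl, hr, hc⟩ | ⟨x, y, l, r, h, hc⟩ | ⟨x, y, l, r, h, hc⟩
  · exact ⟨l, r, hl, hr, by omega⟩
  · obtain ⟨h1, h2, h3⟩ := h.mem_near hG
    exact (h.hasSaving hG hc (h.isEPT_near.hasSaving_zero hG h1 huv h2 h3)).mono (by omega)
  · obtain ⟨h1, h2, h3⟩ := h.mem_near hG
    exact ((h.hasSaving hG hc
      (h.isEPT_near.hasSaving_zero hG h1 huv.symm h2 h3)).mono (by omega)).symm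

/-- The assumption `hfar` replaces balance because it passes to the near part of a cut inside `V`:
`U` is unchanged there and the cut-off parts only shrink. -/
theorem IsEPT.hasSaving_right (hG : G.IsTree) (hS : EdgeConvex G S) (hT : IsEPT G S T)
    (huv : G.Adj u v) (hu : u ∈ S) (hv : v ∈ S)
    (hfar : ∀ x y, G.Adj x y → x ∈ S → y ∈ S → OnSide G v u x → OnSide G v u y →
      OnSide G y x v → (_root_.half G S x y).card ≤ (_root_.half G S u v).card) :
    HasSaving G S u v T (half G S v u).card := by
  induction hn : S.card using Nat.strong_induction_on generalizing S T with
  | _ n ih =>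
    have hcard := card_half_add_card_half hG huv S
    rcases hT.cases_at hG hS huv hu hv with
      ⟨l, r, hl, hr, hc⟩ | ⟨x, y, l, r, h, hc⟩ | ⟨x, y, l, r, h, hc⟩
    · exact ⟨l, r, hl, hr, by omega⟩
    · obtain ⟨h1, h2, h3⟩ := h.mem_near hG
      exact (h.hasSaving hG hc (h.isEPT_near.hasSaving_zero hG h1 huv h2 h3)).mono (by omega)
    · obtain ⟨h1, h2, h3⟩ := h.mem_near hG
      have hlt := card_half_lt hG h.cut_adj.symm h.far_mem
      have hq := hfar x y h.cut_adj h.far_mem h.near_mem h.far_onSide h.near_onSide h.onSide_near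
      have hrec := ih _ (hn ▸ hlt) h1 h.isEPT_near h3 h2 (fun x' y' hxy hx hy hx' hy' hv' => by
        rw [h.half_half_right hG]
        exact (Finset.card_le_card (half_mono half_subset)).trans
          (hfar x' y' hxy (half_subset hx) (half_subset hy) hx' hy' hv')) rfl
      have := h.card_half_half hG
      -- The saving is `|U| + (|V| - |X|) ≥ |V|`, as `|X| ≤ |U|`.
      exact ((h.hasSaving hG hc hrec.symm).mono (by omega)).symm

/-- Cutting along a balanced cut saves at least the size of each part cut by the root. -/
theorem IsBalancedCut.hasSaving (hG : G.IsTree) (hS : EdgeConvex G S)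
    (hb : IsBalancedCut G S s(u, v)) (hxy : G.Adj x y) (hx : x ∈ S) (hy : y ∈ S)
    (hl : IsEPT G (half G S x y) l) (hr : IsEPT G (half G S y x) r)
    (hle : (half G S u v).card ≤ (half G S v u).card) :
    HasSaving G S u v (.node s(x, y) l r) (max (half G S x y).card (half G S y x).card) := by
  obtain ⟨huv, hu, hv⟩ := mem_inducedEdges.1 hb.1
  have hcard := card_half_add_card_half hG huv S
  have hcard' := card_half_add_card_half hG hxy S
  have hc := IsEPT.leafDepthSum_node hG hS hxy hl hr
  have left : ∀ {x y l r}, CutsSide G S u v x y l r →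
      (half G S x y).card + (half G S y x).card = S.card →
      ∀ T : EPTree V, T.leafDepthSum = S.card + l.leafDepthSum + r.leafDepthSum →
      HasSaving G S u v T (max (half G S x y).card (half G S y x).card) := by
    intro x y l r h h' T hc
    obtain ⟨h1, h2, h3⟩ := h.mem_near hG
    have hm := h.isEPT_near.hasSaving_min hG h1 huv h2 h3
    rw [h.half_half_right hG] at hm
    have := h.card_half_half hG
    -- Since `|U| - |X| ≤ |V|`, the minimum is `|U| - |X|` and the saving is `|S| - |X| = |Y|`;
    -- moreover `|X| ≤ |U| ≤ |V| ≤ |Y|`.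
    exact (h.hasSaving hG hc hm).mono (by omega)
  have right : ∀ {x y l r}, CutsSide G S v u x y l r →
      (half G S x y).card + (half G S y x).card = S.card →
      ∀ T : EPTree V, T.leafDepthSum = S.card + l.leafDepthSum + r.leafDepthSum →
      HasSaving G S u v T (max (half G S x y).card (half G S y x).card) := by
    intro x y l r h h' T hc
    obtain ⟨h1, h2, h3⟩ := h.mem_near hG
    have hq := hb.card_half_le hG hS h.cut_adj h.far_mem h.near_mem h.far_onSide
      h.near_onSide h.onSide_near
    have hm := h.isEPT_near.hasSaving_right hG h1 huv h3 h2
      (fun x' y' hxy hx hy hx' hy' hv' => by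
        rw [h.half_half_right hG]
        exact (Finset.card_le_card (half_mono half_subset)).trans
          (hb.card_half_le hG hS hxy (half_subset hx) (half_subset hy) hx' hy' hv'))
    have := h.card_half_half hG
    -- The saving is `|U| + (|V| - |X|) = |Y|`, and `|X| ≤ |U| ≤ |Y|`.
    exact ((h.hasSaving hG hc hm.symm).mono (by omega)).symm
  rcases IsEPT.root_cases hG hS huv hu hv hxy hx hy hl hr with
    (⟨rfl, rfl⟩ | ⟨rfl, rfl⟩) | (h | h) | (h | h)
  · exact ⟨l, r, hl, hr, by omega⟩
  · exact ⟨r, l, hr, hl, by omega⟩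
  · exact left h hcard' _ hc
  · rw [max_comm]; exact left h (by omega) _ (by omega)
  · exact right h hcard' _ hc
  · rw [max_comm]; exact right h (by omega) _ (by omega)

end Savings

/-! ### The induction for the factor `3/2`. -/

section Approximation

variable {V : Type*} {G : SimpleGraph V} {S : Finset V} {u v x y : V} {T T' l r : EPTree V}

theorem IsBalancedCut.symm (h : IsBalancedCut G S s(u, v)) : IsBalancedCut G S s(v, u) := by
  rwa [Sym2.eq_swap]

/-- The balanced cut algorithm is a 3/2-approximation on convex sets with fewer than `n`
vertices. -/
def ApproxBelow (G : SimpleGraph V) (n : ℕ) : Prop :=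
  ∀ (S : Finset V) (T' T : EPTree V), S.card < n → EdgeConvex G S → IsBalancedCutOutput G S T' →
    IsEPT G S T → 2 * T'.leafDepthSum ≤ 3 * T.leafDepthSum

theorem IsBalancedCutOutput.isEPT (h : IsBalancedCutOutput G S T) : IsEPT G S T := by
  induction h with
  | leaf v => exact IsEPT.leaf v
  | node S u v l r he _ _ ihl ihr => exact IsEPT.node S u v l r he.1 ihl ihr

theorem IsBalancedCutOutput.exists_of_ne (hG : G.IsTree) (hS : EdgeConvex G S)
    (h : IsBalancedCutOutput G S T) (hx : x ∈ S) (hy : y ∈ S) (hxy : x ≠ y) :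
    ∃ u v l r, IsBalancedCut G S s(u, v) ∧ IsBalancedCutOutput G (half G S u v) l ∧
      IsBalancedCutOutput G (half G S v u) r ∧
      (half G S u v).card ≤ (half G S v u).card ∧
      T.leafDepthSum = S.card + l.leafDepthSum + r.leafDepthSum := by
  cases h with
  | leaf w =>
    rw [Finset.mem_singleton] at hx hy
    exact absurd (hx.trans hy.symm) hxy
  | node _ u v l r he hl hr =>
    obtain ⟨huv, hu, hv⟩ := mem_inducedEdges.1 he.1
    rw [cutComponent_eq_half hS hu] at hl
    rw [cutComponent_eq_half' hS hv] at hr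
    have hc := IsEPT.leafDepthSum_node hG hS huv hl.isEPT hr.isEPT
    rcases le_total (half G S u v).card (half G S v u).card with hle | hle
    · exact ⟨u, v, l, r, he, hl, hr, hle, hc⟩
    · exact ⟨v, u, r, l, he.symm, hr, hl, hle, by omega⟩

/-- An unbalanced root of `T` improves the approximation guarantee. -/
theorem ApproxBelow.add_card_half_le (hG : G.IsTree) (ih : ApproxBelow G S.card)
    (hS : EdgeConvex G S) (hT' : IsBalancedCutOutput G S T') (hxy : G.Adj x y) (hx : x ∈ S)
    (hy : y ∈ S) (hl : IsEPT G (half G S x y) l) (hr : IsEPT G (half G S y x) r) :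
    2 * T'.leafDepthSum + 3 * (half G S x y).card ≤
      3 * (EPTree.node s(x, y) l r).leafDepthSum + 2 * S.card := by
  obtain ⟨u, v, l', r', hb, hl', hr', hle, hc⟩ := hT'.exists_of_ne hG hS hx hy hxy.ne
  obtain ⟨huv, hu, hv⟩ := mem_inducedEdges.1 hb.1
  obtain ⟨tl, tr, htl, htr, ht⟩ := hb.hasSaving hG hS hxy hx hy hl hr hle
  have h1 := ih _ _ _ (card_half_lt hG huv hv) (hS.half hG huv) hl' htl
  have h2 := ih _ _ _ (card_half_lt hG huv.symm hu) (hS.half hG huv.symm) hr' htr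
  omega

theorem ApproxBelow.mono {m n : ℕ} (h : ApproxBelow G n) (hmn : m ≤ n) : ApproxBelow G m :=
  fun S T' T hS => h S T' T (hS.trans_le hmn)

theorem CutsSide.add_card_half_le {t : EPTree V} (hG : G.IsTree) (h : CutsSide G S u v x y l r)
    (ih : ApproxBelow G S.card) (hT' : IsBalancedCutOutput G (half G S u v) T')
    (ht : IsEPT G (half G (half G S y x) u v) t) :
    2 * T'.leafDepthSum + 3 * (half G S x y).card ≤
      3 * ((half G S u v).card + l.leafDepthSum + t.leafDepthSum) + 2 * (half G S u v).card := by
  have hc := h.convex.half hG h.adj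
  have hl := h.isEPT_far
  have hcost := (h.isEPT_node hG ht).2
  rw [← CutsSide.half_half_comm] at ht
  rw [← h.half_half_far hG] at hl
  have := (ih.mono (card_half_lt hG h.adj h.right_mem).le).add_card_half_le hG hc hT' h.cut_adj
    (mem_half.2 ⟨h.far_mem, h.far_onSide⟩) (mem_half.2 ⟨h.near_mem, h.near_onSide⟩) hl ht
  rwa [h.half_half_far hG, hcost] at this

theorem ApproxBelow.step (hG : G.IsTree) (ih : ApproxBelow G S.card)
    (hS : EdgeConvex G S) (hb : IsBalancedCut G S s(u, v))
    (hl' : IsBalancedCutOutput G (half G S u v) l) (hr' : IsBalancedCutOutput G (half G S v u) r)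
    (hle : (half G S u v).card ≤ (half G S v u).card) (hT : IsEPT G S T) :
    2 * (S.card + l.leafDepthSum + r.leafDepthSum) ≤ 3 * T.leafDepthSum := by
  obtain ⟨huv, hu, hv⟩ := mem_inducedEdges.1 hb.1
  have hcard := card_half_add_card_half hG huv S
  have ihl : ∀ {t}, IsEPT G (half G S u v) t → 2 * l.leafDepthSum ≤ 3 * t.leafDepthSum :=
    fun ht => ih _ _ _ (card_half_lt hG huv hv) (hS.half hG huv) hl' ht
  have ihr : ∀ {t}, IsEPT G (half G S v u) t → 2 * r.leafDepthSum ≤ 3 * t.leafDepthSum :=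
    fun ht => ih _ _ _ (card_half_lt hG huv.symm hu) (hS.half hG huv.symm) hr' ht
  rcases hT.cases_at hG hS huv hu hv with
    ⟨tl, tr, htl, htr, hc⟩ | ⟨x, y, tx, ty, h, hc⟩ | ⟨x, y, tx, ty, h, hc⟩
  · have := ihl htl
    have := ihr htr
    omega
  · obtain ⟨h1, h2, h3⟩ := h.mem_near hG
    obtain ⟨sl, sr, hsl, hsr, hs⟩ := h.isEPT_near.hasSaving_min hG h1 huv h2 h3
    have hl := h.add_card_half_le hG ih hl' hsl
    have hcr := h.card_half_half hG
    rw [h.half_half_right hG] at hsr hs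
    have hr := ihr hsr
    -- The bounds add up to the requirement `2|S| + 2|U| ≤ 3|S|`, which is `|U| ≤ |V|`.
    omega
  · obtain ⟨h1, h2, h3⟩ := h.mem_near hG
    have hcr := h.card_half_half hG
    have hq := hb.card_half_le hG hS h.cut_adj h.far_mem h.near_mem h.far_onSide
      h.near_onSide h.onSide_near
    have hca := h.half_half_right hG
    have hcS := card_half_add_card_half hG h.cut_adj S
    -- Splitting saves `|S| - |X|`, which is at least `2|S|/3` exactly in the small case.
    by_cases hsmall : 3 * (half G S x y).card ≤ S.card
    · obtain ⟨tl, tr, htl, htr, ht⟩ : HasSaving G S u v T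
          ((half G S u v).card + (half G (half G S y x) v u).card) := by
        refine (h.hasSaving hG hc (h.isEPT_near.hasSaving_right hG h1 huv h3 h2
          (fun x' y' hxy hx hy hx' hy' hv' => ?_)).symm).symm
        rw [hca]
        exact (Finset.card_le_card (half_mono half_subset)).trans
          (hb.card_half_le hG hS hxy (half_subset hx) (half_subset hy) hx' hy' hv')
      have := ihl htl
      have := ihr htr
      omega
    -- Now `|U| ≥ |X| > |S|/3`, hence `|V| < 2|U|`. The cases are the positions of the root of the
    -- near subtree: `uv`, inside `U`, or inside `V`.
    · have hcn := card_half_add_card_half hG huv (half G S y x)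
      rcases h.isEPT_near.cases_at hG h1 huv h3 h2 with
        ⟨tl, tr, htl, htr, hc'⟩ | ⟨x', y', tx', ty', h', hc'⟩ | ⟨x', y', tx', ty', h', hc'⟩
      · have hr := ihr (h.isEPT_node hG htr).1
        rw [(h.isEPT_node hG htr).2] at hr
        rw [hca] at htl hcn
        have hl := ihl htl
        omega
      · obtain ⟨g1, g2, g3⟩ := h'.mem_near hG
        obtain ⟨sl, sr, hsl, hsr, hs⟩ := h'.isEPT_near.hasSaving_min hG g1 huv g2 g3
        -- Two bounds on `l` are needed. With `X'` the part of `U` cut off by `x'y'`, the sharp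
        -- bound `hl1` serves when the minimum in `hs` is `|U| - |X'|`, the plain bound `hl2` when
        -- it is `|V| - |X|`.
        have hl1 := h'.add_card_half_le hG
          (ih.mono (Finset.card_le_card half_subset)) (by rwa [hca]) hsl
        obtain ⟨hE, hcost⟩ := h'.isEPT_node hG hsl
        have hcr' := h'.card_half_half hG
        rw [h'.half_half_right hG] at hsr hs
        have hr := h.add_card_half_le hG ih hr' hsr
        rw [hca] at hE hcost hl1 hcr' hcn
        have hl2 := ihl hE
        omega
      · obtain ⟨g1, g2, g3⟩ := h'.mem_near hG
        -- Both top edges lie inside `V`, so the leaves in `U` rise by two levels: a saving of `2|U|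
        -- > 2|S|/3`.
        obtain ⟨tl, tr, htl, htr, ht⟩ :=
          (h'.hasSaving hG hc' (h'.isEPT_near.hasSaving_zero hG g1 huv.symm g2 g3)).symm
        have hr := ihr (h.isEPT_node hG htr).1
        rw [(h.isEPT_node hG htr).2] at hr
        rw [hca] at htl ht hcn
        have hl := ihl htl
        omega

theorem approxBelow (hG : G.IsTree) (n : ℕ) : ApproxBelow G n := by
  induction n with
  | zero => exact fun S _ _ h => absurd h (Nat.not_lt_zero _)
  | succ n ih =>
    intro S T' T hn hS hT' hT
    have ihS : ApproxBelow G S.card := ih.mono (Nat.lt_succ_iff.1 hn)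
    by_cases hnt : ∃ x ∈ S, ∃ y ∈ S, x ≠ y
    · obtain ⟨x, hx, y, hy, hxy⟩ := hnt
      obtain ⟨u, v, l, r, hb, hl, hr, hle, hc⟩ := hT'.exists_of_ne hG hS hx hy hxy
      rw [hc]
      exact ihS.step hG hS hb hl hr hle hT
    · push Not at hnt
      cases hT' with
      | leaf v => simp [EPTree.leafDepthSum, EPTree.leafDepthSumFrom]
      | node _ u v l r he hl hr =>
        obtain ⟨huv, hu, hv⟩ := mem_inducedEdges.1 he.1
        exact absurd (hnt u hu v hv) huv.ne

/-! ### Existence of an output. -/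

theorem EdgeConvex.exists_mem_adj (hG : G.IsTree) (hS : EdgeConvex G S) (hx : x ∈ S)
    (hy : y ∈ S) (hxy : x ≠ y) : ∃ z ∈ S, G.Adj x z := by
  obtain ⟨p, hp⟩ := (hG.connected.preconnected x y).exists_isPath
  cases p with
  | nil => exact absurd rfl hxy
  | @cons _ z _ h p =>
    rw [SimpleGraph.Walk.cons_isPath_iff] at hp
    refine ⟨z, hS z x h.symm ⟨y, hy, ⟨p.toDeleteEdge s(z, x) fun he => ?_⟩⟩
      ⟨x, hx, onSide_self _ _ _⟩, h⟩
    exact hp.2 (SimpleGraph.Walk.snd_mem_support_of_mem_edges _ he)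

theorem exists_isBalancedCutOutput [Finite V] (hG : G.IsTree) (hS : EdgeConvex G S)
    (hne : S.Nonempty) : ∃ T, IsBalancedCutOutput G S T := by
  induction hn : S.card using Nat.strong_induction_on generalizing S with
  | _ n ih =>
    obtain ⟨x, hx⟩ := hne
    by_cases hs : S = {x}
    · exact ⟨.leaf x, hs ▸ IsBalancedCutOutput.leaf x⟩
    · obtain ⟨y, hy, hyx⟩ : ∃ y ∈ S, y ≠ x := by
        by_contra! h
        exact hs (Finset.eq_singleton_iff_unique_mem.2 ⟨hx, h⟩)
      obtain ⟨z, hz, hxz⟩ := hS.exists_mem_adj hG hx hy hyx.symm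
      obtain ⟨e, he, hmin⟩ := Set.exists_min_image (inducedEdges G S) (maxComponentSize G S)
        (Set.toFinite _) ⟨s(x, z), mem_inducedEdges.2 ⟨hxz, hx, hz⟩⟩
      induction e using Sym2.ind with
      | _ u v =>
        obtain ⟨huv, hu, hv⟩ := mem_inducedEdges.1 he
        obtain ⟨l, hl⟩ := ih _ (hn ▸ card_half_lt hG huv hv) (hS.half hG huv)
          ⟨u, mem_half.2 ⟨hu, onSide_self _ _ _⟩⟩ rfl
        obtain ⟨r, hr⟩ := ih _ (hn ▸ card_half_lt hG huv.symm hu) (hS.half hG huv.symm)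
          ⟨v, mem_half.2 ⟨hv, onSide_self _ _ _⟩⟩ rfl
        refine ⟨.node s(u, v) l r, IsBalancedCutOutput.node S u v l r ⟨he, hmin⟩ ?_ ?_⟩
        · rwa [cutComponent_eq_half hS hu]
        · rwa [cutComponent_eq_half' hS hv]

theorem edgeConvex_univ [Fintype V] (G : SimpleGraph V) : EdgeConvex G Finset.univ :=
  fun _ _ _ _ _ => Finset.mem_univ _

end Approximation

theorem mainTheorem1 {V : Type*} [Fintype V] (G : SimpleGraph V) (hG : G.IsTree) :
    (∃ T : EPTree V, IsBalancedCutOutput G Finset.univ T) ∧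
      ∀ T : EPTree V, IsBalancedCutOutput G Finset.univ T →
        IsEPT G Finset.univ T ∧ (T.leafDepthSum : ℝ) ≤ 3 / 2 * (eptSum G : ℝ) := by
  have := hG.connected.nonempty
  refine ⟨exists_isBalancedCutOutput hG (edgeConvex_univ G) Finset.univ_nonempty,
    fun T hT => ⟨hT.isEPT, ?_⟩⟩
  obtain ⟨T₀, hT₀, h₀⟩ : eptSum G ∈
      {n | ∃ T : EPTree V, IsEPT G Finset.univ T ∧ T.leafDepthSum = n} :=
    Nat.sInf_mem ⟨_, T, hT.isEPT, rfl⟩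
  have h := approxBelow hG _ _ T T₀ (Nat.lt_succ_self _) (edgeConvex_univ G) hT hT₀
  rw [h₀] at h
  have h' : (2 : ℝ) * T.leafDepthSum ≤ 3 * eptSum G := by exact_mod_cast h
  linarith
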